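/- Let $(\mathcal E,\mathcal F,\mu)$ be a probability space, let $X_i:\mathcal E\to\mathcal X_i$, $i\ge 0$, be measurable maps into measurable spaces, and put $\mathcal Y_n=\mathcal X_n\times\mathcal X_{n+1}\times\cdots$ and $\overline X_n=(X_n,X_{n+1},\dots)$. Let $B$ be a set of real $\mu$-integrable functions on $\mathcal E$ equipped with a real-valued functional $\|\cdot\|$, and assume that there is a sequence $\delta_n\to 0$ such that for every $n$, every $s\in B$ with $\int s\,d\mu=1$ and every bounded measurable $f:\mathcal Y_n\to\mathbb C$, $$\left|\int s\, f(\overline X_n)\,d\mu-\int s\,d\mu\int f(\overline X_n)\,d\mu\right|\le \|s\|\,\sup|f|\,\delta_n .$$ Let $g_j:\mathcal Y_j\to\mathbb R^d$, $j\ge 0$, be measurable functions and put $S_n=\sum_{j=0}^{n-1}g_j(\overline X_j)$. Let $r:\mathcal E\to[0,\infty)$ satisfy $\int r\,d\mu=1$ and let $\nu$ be the probability measure $d\nu=r\,d\mu$. Suppose that one of the following holds: (i) $r\in B$, and $\int|S_n|\,d\mu<\infty$ and $\int r|S_n|\,d\mu<\infty$ for every $n$; (ii) for some conjugate exponents $p,q\in[1,\infty]$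 (i.e. $\frac1p+\frac1q=1$), $r$ lies in the $L^p(\mu)$-closure of $\{s\in B\cap L^p(\mu):\int s\,d\mu=1\}$ (which for a set $B$ closed under multiplication by positive scalars just means that $r$ lies in the $L^p(\mu)$-closure of $B\cap L^p(\mu)$), and $g_j(\overline X_j)\in L^q(\mu)$ for every $j\ge 0$. Let $(b_n)_{n\ge1}$ be positive numbers with $b_n\to\infty$, and put $\mathcal S_n(t)=S_{[nt]}$, $t\ge 0$. If the processes $\mathcal S_n(\cdot)/b_n$, considered under $\mu$, converge in distribution as $n\to\infty$ in the Skorokhod space $D([0,\infty),\mathbb R^d)$ (with the $J_1$ topology), then considered under $\nu$ they converge in distribution to the same limit. If moreover $r>0$ $\mu$-almost surely, then conversely convergence in distribution under $\nu$ implies convergence in distribution under $\mu$ to the same limit. -/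

import Mathlib

open MeasureTheory Filter Topology Uniformity
open scoped NNReal ENNReal

noncomputable section

/-! ### The Skorokhod space `D([0,∞), E)` with the `J₁` topology -/

/-- A path `[0,∞) → E` that is right-continuous and has a left limit at every point
(at `0` the left limit is an empty condition). -/
def IsCadlag {E : Type*} [TopologicalSpace E] (x : ℝ≥0 → E) : Prop :=
  ∀ t, ContinuousWithinAt x (Set.Ici t) t ∧ ∃ l, Tendsto x (𝓝[<] t) (𝓝 l)

/-- The set `D([0,∞), E)` of càdlàg paths. -/
structure SkorokhodSpace (E : Type*) [TopologicalSpace E] where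
  /-- the underlying path -/
  path : ℝ≥0 → E
  isCadlag : IsCadlag path

/-- The pairs `(x, y)` of paths such that for some time change `τ` (an increasing bijection of
`[0,∞)` onto itself) we have `sup_t |τ t - t| ≤ ε` and `sup_{t ≤ 1/ε} d(y (τ t), x t) ≤ ε`. -/
def skorokhodEntourage (E : Type*) [MetricSpace E] (ε : ℝ) :
    Set (SkorokhodSpace E × SkorokhodSpace E) :=
  {z | ∃ τ : ℝ≥0 ≃o ℝ≥0, (∀ t, |(τ t : ℝ) - t| ≤ ε) ∧
    ∀ t : ℝ≥0, (t : ℝ) ≤ 1 / ε → dist (z.2.path (τ t)) (z.1.path t) ≤ ε}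

theorem skorokhodEntourage_mono {E : Type*} [MetricSpace E] {ε ε' : ℝ} (h0 : 0 < ε)
    (h : ε ≤ ε') : skorokhodEntourage E ε ⊆ skorokhodEntourage E ε' := by
  rintro z ⟨τ, h1, h2⟩
  refine ⟨τ, fun t => (h1 t).trans h, fun t ht => (h2 t (ht.trans ?_)).trans h⟩
  exact one_div_le_one_div_of_le h0 h

theorem skorokhodEntourage_half {ε : ℝ} (h0 : 0 < ε) (h1 : ε ≤ 1) :
    1 / ε + ε / 2 ≤ 1 / (ε / 2) := by
  have h2 : (1 : ℝ) ≤ 1 / ε := by rw [le_div_iff₀ h0]; linarith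
  have h3 : 1 / (ε / 2) = 2 * (1 / ε) := by field_simp
  linarith

/-- The sets `skorokhodEntourage E ε`, `0 < ε`, are a basis of a uniformity. -/
def skorokhodBasis (E : Type*) [MetricSpace E] :
    FilterBasis (SkorokhodSpace E × SkorokhodSpace E) where
  sets := {V | ∃ ε : ℝ, 0 < ε ∧ V = skorokhodEntourage E ε}
  nonempty := ⟨_, 1, one_pos, rfl⟩
  inter_sets := by
    rintro _ _ ⟨ε, hε, rfl⟩ ⟨ε', hε', rfl⟩
    exact ⟨_, ⟨min ε ε', lt_min hε hε', rfl⟩, Set.subset_inter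
      (skorokhodEntourage_mono (lt_min hε hε') (min_le_left _ _))
      (skorokhodEntourage_mono (lt_min hε hε') (min_le_right _ _))⟩

/-- The uniformity generated by the sets `skorokhodEntourage E ε`, `0 < ε`. Its topology is the
Skorokhod `J₁` topology: `xₙ → x` iff there are time changes `τₙ` such that
`sup_t |τₙ t - t| → 0` and `sup_{t ≤ m} d(xₙ (τₙ t), x t) → 0` for every `m`. -/
instance SkorokhodSpace.instUniformSpace (E : Type*) [MetricSpace E] :
    UniformSpace (SkorokhodSpace E) :=
  UniformSpace.ofCore <| UniformSpace.Core.mkOfBasis (skorokhodBasis E)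
    (by
      rintro _ ⟨ε, hε, rfl⟩ x
      exact ⟨OrderIso.refl _, fun t => by simpa using hε.le, fun t _ => by simpa using hε.le⟩)
    (by
      rintro _ ⟨ε, hε, rfl⟩
      have hm : 0 < min ε 1 := lt_min hε one_pos
      refine ⟨_, ⟨min ε 1 / 2, by positivity, rfl⟩, ?_⟩
      rintro z ⟨τ, h1, h2⟩
      refine skorokhodEntourage_mono hm (min_le_left ε 1) ?_
      have h4 := skorokhodEntourage_half hm (min_le_right ε 1)
      generalize min ε 1 = η at *
      refine ⟨τ.symm, fun t => ?_, fun t ht => ?_⟩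
      · have h := h1 (τ.symm t)
        rw [OrderIso.apply_symm_apply, abs_sub_comm] at h
        linarith
      · have h := h1 (τ.symm t)
        have h3 := h2 (τ.symm t)
        rw [OrderIso.apply_symm_apply] at h h3
        rw [dist_comm]
        refine (h3 ?_).trans (by linarith)
        linarith [(abs_le.1 h).1])
    (by
      rintro _ ⟨ε, hε, rfl⟩
      have hm : 0 < min ε 1 := lt_min hε one_pos
      refine ⟨_, ⟨min ε 1 / 2, by positivity, rfl⟩, ?_⟩
      rintro ⟨x, z⟩ ⟨y, ⟨τ, h1, h2⟩, ⟨σ, h3, h4⟩⟩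
      refine skorokhodEntourage_mono hm (min_le_left ε 1) ?_
      have h5 := skorokhodEntourage_half hm (min_le_right ε 1)
      generalize min ε 1 = η at *
      refine ⟨τ.trans σ, fun t => ?_, fun t ht => ?_⟩
      · have h6 := abs_le.1 (h1 t)
        have h7 := abs_le.1 (h3 (τ t))
        rw [OrderIso.trans_apply, abs_le]
        constructor <;> linarith [h6.1, h6.2, h7.1, h7.2]
      · have h6 := abs_le.1 (h1 t)
        have h7 := h2 t (by linarith)
        have h8 := h4 (τ t) (by linarith [h6.2])
        rw [OrderIso.trans_apply]
        exact (dist_triangle _ _ _).trans (by dsimp only at h7 h8 ⊢; linarith))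

/-- The Borel `σ`-algebra of the Skorokhod topology. -/
instance SkorokhodSpace.instMeasurableSpace (E : Type*) [MetricSpace E] :
    MeasurableSpace (SkorokhodSpace E) := borel _

instance SkorokhodSpace.instBorelSpace (E : Type*) [MetricSpace E] :
    BorelSpace (SkorokhodSpace E) := ⟨rfl⟩

/-- The step path `t ↦ v ⌊n t⌋` of a sequence `v` is càdlàg. -/
theorem isCadlag_step {E : Type*} [TopologicalSpace E] (v : ℕ → E) (n : ℕ) :
    IsCadlag (fun t : ℝ≥0 => v ⌊(n : ℝ≥0) * t⌋₊) := by
  intro t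
  have hmono : Monotone (fun s : ℝ≥0 => ⌊(n : ℝ≥0) * s⌋₊) := fun a b h =>
    Nat.floor_mono (mul_le_mul_right h _)
  constructor
  · have h1 : ∀ᶠ s in 𝓝 t, (n : ℝ≥0) * s < ⌊(n : ℝ≥0) * t⌋₊ + 1 :=
      ((continuous_const.mul continuous_id).tendsto t).eventually_lt_const
        (Nat.lt_floor_add_one _)
    have h2 : ∀ᶠ s in 𝓝[≥] t, v ⌊(n : ℝ≥0) * t⌋₊ = v ⌊(n : ℝ≥0) * s⌋₊ := by
      filter_upwards [h1.filter_mono nhdsWithin_le_nhds, self_mem_nhdsWithin] with s hs hts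
      congr 1
      refine le_antisymm (hmono hts) (Nat.lt_succ_iff.1 ?_)
      exact (Nat.floor_lt' (Nat.succ_ne_zero _)).2 (by push_cast; exact hs)
    exact tendsto_const_nhds.congr' h2
  · refine ⟨v (sSup ((fun s : ℝ≥0 => ⌊(n : ℝ≥0) * s⌋₊) '' Set.Iio t)), ?_⟩
    exact (continuous_of_discreteTopology.tendsto _).comp (hmono.tendsto_nhdsLT t)

/-! ### The process, its partial sums and the decay of correlations -/

/-- The product `𝒴ₙ = 𝒳ₙ × 𝒳ₙ₊₁ × ⋯`, with the product `σ`-algebra. -/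
abbrev TailSpace (𝒳 : ℕ → Type*) (n : ℕ) : Type _ := ∀ i : Set.Ici n, 𝒳 i

/-- `X̄ₙ = (Xₙ, Xₙ₊₁, …)`. -/
def tailMap {Ω : Type*} {𝒳 : ℕ → Type*} (X : ∀ i, Ω → 𝒳 i) (n : ℕ) (ω : Ω) : TailSpace 𝒳 n :=
  fun i => X i ω

/-- `Sₙ = ∑_{j < n} g_j(X_j, X_{j+1}, …)`. -/
def partialSum {Ω : Type*} {𝒳 : ℕ → Type*} {d : ℕ} (X : ∀ i, Ω → 𝒳 i)
    (g : ∀ j, TailSpace 𝒳 j → EuclideanSpace ℝ (Fin d)) (n : ℕ) (ω : Ω) :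
    EuclideanSpace ℝ (Fin d) :=
  ∑ j ∈ Finset.range n, g j (tailMap X j ω)

/-- The random path `t ↦ S_{⌊n t⌋} / b_n`. -/
def sumProcess {Ω : Type*} {𝒳 : ℕ → Type*} {d : ℕ} (X : ∀ i, Ω → 𝒳 i)
    (g : ∀ j, TailSpace 𝒳 j → EuclideanSpace ℝ (Fin d)) (b : ℕ → ℝ) (n : ℕ) (ω : Ω) :
    SkorokhodSpace (EuclideanSpace ℝ (Fin d)) where
  path := fun t => (b n)⁻¹ • partialSum X g ⌊(n : ℝ≥0) * t⌋₊ ω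
  isCadlag := isCadlag_step (fun k => (b n)⁻¹ • partialSum X g k ω) n

/-- Decay of correlations with respect to a set `B` of integrable functions carrying a real
valued functional `N` (the "norm"): there is a sequence `δₙ → 0` such that for all `n`, all
`s ∈ B` with `∫ s dμ = 1` and all bounded measurable `f : 𝒴ₙ → ℂ`,
`|∫ s f(X̄ₙ) dμ - ∫ s dμ ∫ f(X̄ₙ) dμ| ≤ N(s) sup|f| δₙ`. -/
def DecayOfCorrelations {Ω : Type*} [MeasurableSpace Ω] (μ : Measure Ω) {𝒳 : ℕ → Type*}
    [∀ i, MeasurableSpace (𝒳 i)] (X : ∀ i, Ω → 𝒳 i) (B : Set (Ω → ℝ))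
    (N : (Ω → ℝ) → ℝ) : Prop :=
  (∀ s ∈ B, Integrable s μ) ∧
  ∃ δ : ℕ → ℝ, Tendsto δ atTop (𝓝 0) ∧
    ∀ n, ∀ s ∈ B, ∫ ω, s ω ∂μ = 1 →
      ∀ f : TailSpace 𝒳 n → ℂ, Measurable f → BddAbove (Set.range fun y => ‖f y‖) →
        ‖∫ ω, (s ω : ℂ) * f (tailMap X n ω) ∂μ
            - ((∫ ω, s ω ∂μ : ℝ) : ℂ) * ∫ ω, f (tailMap X n ω) ∂μ‖
          ≤ N s * (⨆ y, ‖f y‖) * δ n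

/-- `r` lies in the `L^p(μ)`-closure of the set `A` of functions. -/
def MemLpClosure {Ω : Type*} [MeasurableSpace Ω] (p : ℝ≥0∞) (μ : Measure Ω) (A : Set (Ω → ℝ))
    (r : Ω → ℝ) : Prop :=
  ∀ ε : ℝ≥0∞, 0 < ε → ∃ s ∈ A, eLpNorm (r - s) p μ < ε

end

open MeasureTheory Filter Topology Uniformity
open scoped NNReal ENNReal

/-! ### Weak convergence and uniformly continuous test functions -/

/-! Write `W n` for the normalised path. Integrating `F (W n)` against `ν` is integrating `r * F (W
n)` against `μ`, so it suffices that `∫ (r - 1) * F (W n) ∂μ → 0` for bounded uniformly continuous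
`F`; this is symmetric in `μ` and `ν` up to sign and gives both directions.

Since `b n → ∞`, removing the first `k` terms of the sums moves `W n` by a vanishing amount and
leaves a function of `X̄ₖ`. Both paths may fail to converge pointwise, hence the need for uniform
continuity of `F`. Approximate `r` in `L¹` by some `s ∈ B` of integral one. Decay of correlations
bounds the covariance of `s` with every function of `X̄ₖ` bounded by `M` at once, so `k` can be
fixed before `n → ∞`. These steps are combined in `DecayOfCorrelations.tendsto_integral_mul_sub`. -/

/-- On a space whose uniformity is countably generated, weak convergence of probability measures
can be tested on bounded uniformly continuous functions. -/
theorem tendsto_probabilityMeasure_of_forall_uniformContinuous {ι E : Type*} [UniformSpace E]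
    [IsCountablyGenerated (𝓤 E)] [MeasurableSpace E] [OpensMeasurableSpace E] {l : Filter ι}
    [l.IsCountablyGenerated] {μs : ι → ProbabilityMeasure E} {μ : ProbabilityMeasure E}
    (h : ∀ F : E → ℝ, UniformContinuous F → (∃ M, ∀ x, |F x| ≤ M) →
      Tendsto (fun i => ∫ x, F x ∂(μs i : Measure E)) l (𝓝 (∫ x, F x ∂(μ : Measure E)))) :
    Tendsto μs l (𝓝 μ) := by
  -- This pseudometric induces the given uniformity, so Lipschitz test functions are uniformly
  -- continuous for it.
  let _ := UniformSpace.pseudoMetricSpace E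
  refine tendsto_iff_forall_lipschitz_integral_tendsto.2 ?_
  rintro F ⟨C, hC⟩ ⟨L, hL⟩
  refine h F hL.uniformContinuous ?_
  rcases isEmpty_or_nonempty E with hE | ⟨⟨x₀⟩⟩
  · exact ⟨0, fun x => hE.elim x⟩
  · refine ⟨|F x₀| + C, fun x => ?_⟩
    have h1 := hC x x₀
    rw [Real.dist_eq] at h1
    linarith [abs_sub_abs_le_abs_sub (F x) (F x₀)]

/-- If the integrals of bounded uniformly continuous functions of `W n` under `μ` and under `ν`
are asymptotically equal, then convergence in distribution carries over from `μ` to `ν`. -/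
theorem TendstoInDistribution.of_forall_uniformContinuous {Ω E : Type*} [MeasurableSpace Ω]
    [UniformSpace E] [IsCountablyGenerated (𝓤 E)] [MeasurableSpace E] [BorelSpace E]
    {μ ν : Measure Ω} [IsProbabilityMeasure μ] [IsProbabilityMeasure ν] {P : Measure E}
    [IsProbabilityMeasure P] {W : ℕ → Ω → E} (hW : ∀ n, Measurable (W n))
    (h : ∀ F : E → ℝ, UniformContinuous F → (∃ M, ∀ x, |F x| ≤ M) →
      Tendsto (fun n => ∫ ω, F (W n ω) ∂ν - ∫ ω, F (W n ω) ∂μ) atTop (𝓝 0))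
    (hμ : TendstoInDistribution W atTop id (fun _ => μ) P) :
    TendstoInDistribution W atTop id (fun _ => ν) P where
  forall_aemeasurable n := (hW n).aemeasurable
  aemeasurable_limit := aemeasurable_id
  tendsto := by
    refine tendsto_probabilityMeasure_of_forall_uniformContinuous fun F hF hFb => ?_
    have hlim := ProbabilityMeasure.tendsto_iff_forall_integral_tendsto.1 hμ.tendsto
    obtain ⟨M, hM⟩ := hFb
    have h1 := hlim (BoundedContinuousFunction.ofNormedAddCommGroup F hF.continuous M hM)
    have h2 := (h F hF ⟨M, hM⟩).add h1
    simp only [ProbabilityMeasure.coe_mk, BoundedContinuousFunction.coe_ofNormedAddCommGroup,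
      zero_add] at h2 ⊢
    refine h2.congr fun n => ?_
    rw [integral_map (hW n).aemeasurable hF.continuous.measurable.aestronglyMeasurable,
      integral_map (hW n).aemeasurable hF.continuous.measurable.aestronglyMeasurable]
    ring

/-! ### Step paths in the Skorokhod space -/

theorem hasBasis_uniformity_skorokhodSpace (E : Type*) [MetricSpace E] :
    (𝓤 (SkorokhodSpace E)).HasBasis (fun ε : ℝ => 0 < ε) (skorokhodEntourage E) := by
  have h : (𝓤 (SkorokhodSpace E)) = (skorokhodBasis E).filter := rfl
  rw [h]
  refine ⟨fun t => ?_⟩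
  rw [FilterBasis.mem_filter_iff]
  constructor
  · rintro ⟨_, ⟨ε, hε, rfl⟩, ht⟩
    exact ⟨ε, hε, ht⟩
  · rintro ⟨ε, hε, ht⟩
    exact ⟨_, ⟨ε, hε, rfl⟩, ht⟩

/-- Makes the space pseudometrizable, so that uniformly continuous test functions determine weak
convergence. -/
instance SkorokhodSpace.isCountablyGenerated_uniformity (E : Type*) [MetricSpace E] :
    IsCountablyGenerated (𝓤 (SkorokhodSpace E)) := by
  have h : (𝓤 (SkorokhodSpace E)).HasBasis (fun _ : ℕ => True)
      (fun n => skorokhodEntourage E (1 / ((n : ℝ) + 1))) := by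
    refine (hasBasis_uniformity_skorokhodSpace E).to_hasBasis (fun ε hε => ?_)
      fun n _ => ⟨_, Nat.one_div_pos_of_nat, subset_rfl⟩
    obtain ⟨n, hn⟩ := exists_nat_one_div_lt hε
    exact ⟨n, trivial, skorokhodEntourage_mono Nat.one_div_pos_of_nat hn.le⟩
  exact h.isCountablyGenerated

/-- The step path `t ↦ v ⌊n t⌋` as an element of the Skorokhod space. -/
noncomputable def SkorokhodSpace.step {E : Type*} [TopologicalSpace E] (n : ℕ) (v : ℕ → E) :
    SkorokhodSpace E where
  path := fun t => v ⌊(n : ℝ≥0) * t⌋₊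
  isCadlag := isCadlag_step v n

theorem mem_skorokhodEntourage_of_dist_le {E : Type*} [MetricSpace E] {ε : ℝ} (hε : 0 ≤ ε)
    {x y : SkorokhodSpace E}
    (h : ∀ t : ℝ≥0, (t : ℝ) ≤ 1 / ε → dist (y.path t) (x.path t) ≤ ε) :
    (x, y) ∈ skorokhodEntourage E ε :=
  ⟨OrderIso.refl _, fun t => by simpa using hε, h⟩

/-- On `[0, 1/ε]` a step path reads only the coordinates up to `⌊n/ε⌋`, so closeness in the product
topology suffices. It serves to make the random paths Borel measurable. -/
theorem SkorokhodSpace.continuous_step {E : Type*} [MetricSpace E] (n : ℕ) :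
    Continuous (SkorokhodSpace.step n : (ℕ → E) → SkorokhodSpace E) := by
  refine continuous_iff_continuousAt.2 fun v => ?_
  rw [ContinuousAt, (nhds_basis_uniformity' (hasBasis_uniformity_skorokhodSpace E)).tendsto_right_iff]
  intro ε hε
  have h : ∀ᶠ w in 𝓝 v, ∀ m ∈ Finset.range (⌊(n : ℝ) * (1 / ε)⌋₊ + 1), dist (w m) (v m) ≤ ε := by
    rw [Filter.eventually_all_finset]
    intro m _
    filter_upwards [((continuous_apply m).tendsto v).eventually (Metric.closedBall_mem_nhds _ hε)]
      with w hw using hw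
  filter_upwards [h] with w hw
  refine mem_skorokhodEntourage_of_dist_le hε.le fun t ht => hw _ ?_
  rw [Finset.mem_range, Nat.lt_succ_iff]
  refine Nat.le_floor ?_
  have h1 : ((⌊(n : ℝ≥0) * t⌋₊ : ℝ≥0) : ℝ) ≤ ((n * t : ℝ≥0) : ℝ) :=
    NNReal.coe_le_coe.2 (Nat.floor_le zero_le)
  push_cast at h1
  exact h1.trans (by gcongr)

/-! ### Dropping the first terms of the sums -/

section Tail

variable {Ω : Type*} {𝒳 : ℕ → Type*} {d : ℕ}

/-- The projection `𝒴ₖ → 𝒴ₖ₊ᵢ`. -/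
def TailSpace.drop (k i : ℕ) (y : TailSpace 𝒳 k) : TailSpace 𝒳 (k + i) :=
  fun l => y ⟨l, (Nat.le_add_right k i).trans l.2⟩

/-- The sum of the `g_j` over `k ≤ j < m`, as a function on `𝒴ₖ`. -/
def tailSum (g : ∀ j, TailSpace 𝒳 j → EuclideanSpace ℝ (Fin d)) (k m : ℕ) (y : TailSpace 𝒳 k) :
    EuclideanSpace ℝ (Fin d) :=
  ∑ i ∈ Finset.range (m - k), g (k + i) (TailSpace.drop k i y)

/-- For `m ≤ k` the truncated `m - k` makes the tail sum empty; with `min m k` the identity then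
needs no case distinction. -/
theorem partialSum_eq_add_tailSum (X : ∀ i, Ω → 𝒳 i)
    (g : ∀ j, TailSpace 𝒳 j → EuclideanSpace ℝ (Fin d)) (k m : ℕ) (ω : Ω) :
    partialSum X g m ω = partialSum X g (min m k) ω + tailSum g k m (tailMap X k ω) := by
  rcases le_total m k with h | h
  · simp [tailSum, h]
  · obtain ⟨i, rfl⟩ := Nat.exists_eq_add_of_le h
    simp only [tailSum, partialSum, min_eq_right h, Nat.add_sub_cancel_left]
    exact Finset.sum_range_add _ _ _

/-- The normalised path of the sums without their first `k` terms, as a function on `𝒴ₖ`. -/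
noncomputable def tailProcess (g : ∀ j, TailSpace 𝒳 j → EuclideanSpace ℝ (Fin d)) (b : ℕ → ℝ) (k n : ℕ)
    (y : TailSpace 𝒳 k) : SkorokhodSpace (EuclideanSpace ℝ (Fin d)) :=
  SkorokhodSpace.step n fun m => (b n)⁻¹ • tailSum g k m y

/-- Dropping the first `k` terms of the sums does not matter asymptotically. -/
theorem eventually_sumProcess_tailProcess_mem (X : ∀ i, Ω → 𝒳 i)
    (g : ∀ j, TailSpace 𝒳 j → EuclideanSpace ℝ (Fin d)) {b : ℕ → ℝ} (hb : Tendsto b atTop atTop)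
    (k : ℕ) (ω : Ω) {U : Set (SkorokhodSpace (EuclideanSpace ℝ (Fin d)) ×
      SkorokhodSpace (EuclideanSpace ℝ (Fin d)))} (hU : U ∈ 𝓤 (SkorokhodSpace _)) :
    ∀ᶠ n in atTop, (sumProcess X g b n ω, tailProcess g b k n (tailMap X k ω)) ∈ U := by
  obtain ⟨ε, hε, hεU⟩ := (hasBasis_uniformity_skorokhodSpace _).mem_iff.1 hU
  -- `C` dominates every partial sum of index at most `k`, whatever `n` and `t` are.
  set C := ∑ j ∈ Finset.range (k + 1), ‖partialSum X g j ω‖ with hC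
  have h : Tendsto (fun n => |b n|⁻¹ * C) atTop (𝓝 0) := by
    simpa using (tendsto_inv_atTop_zero.comp (tendsto_abs_atTop_atTop.comp hb)).mul_const C
  filter_upwards [h.eventually_le_const hε] with n hn
  refine hεU (mem_skorokhodEntourage_of_dist_le hε.le fun t _ => le_trans ?_ hn)
  simp only [tailProcess, SkorokhodSpace.step, sumProcess]
  generalize ⌊(n : ℝ≥0) * t⌋₊ = m
  rw [dist_comm, dist_eq_norm, ← smul_sub, partialSum_eq_add_tailSum X g k m, add_sub_cancel_right,
    norm_smul, norm_inv, Real.norm_eq_abs]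
  gcongr
  exact Finset.single_le_sum (f := fun j => ‖partialSum X g j ω‖) (fun j _ => norm_nonneg _)
    (Finset.mem_range.2 (Nat.lt_succ_of_le (min_le_right m k)))

variable [∀ i, MeasurableSpace (𝒳 i)]

theorem measurable_tailMap [MeasurableSpace Ω] {X : ∀ i, Ω → 𝒳 i} (hX : ∀ i, Measurable (X i))
    (n : ℕ) : Measurable (tailMap X n) :=
  measurable_pi_lambda _ fun i => hX i

theorem measurable_tailProcess {g : ∀ j, TailSpace 𝒳 j → EuclideanSpace ℝ (Fin d)}
    (hg : ∀ j, Measurable (g j)) (b : ℕ → ℝ) (k n : ℕ) : Measurable (tailProcess g b k n) := by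
  refine (SkorokhodSpace.continuous_step n).measurable.comp (measurable_pi_lambda _ fun m => ?_)
  refine Measurable.const_smul (c := (b n)⁻¹)
    (Finset.measurable_sum _ fun i _ => (hg _).comp ?_)
  exact measurable_pi_lambda _ fun l => measurable_pi_apply _

theorem measurable_sumProcess [MeasurableSpace Ω] {X : ∀ i, Ω → 𝒳 i} (hX : ∀ i, Measurable (X i))
    {g : ∀ j, TailSpace 𝒳 j → EuclideanSpace ℝ (Fin d)} (hg : ∀ j, Measurable (g j)) (b : ℕ → ℝ)
    (n : ℕ) : Measurable (sumProcess X g b n) := by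
  refine (SkorokhodSpace.continuous_step n).measurable.comp (measurable_pi_lambda
    (fun ω m => (b n)⁻¹ • partialSum X g m ω) fun m => ?_)
  exact Measurable.const_smul (c := (b n)⁻¹)
    (Finset.measurable_sum _ fun j _ => (hg j).comp (measurable_tailMap hX j))

end Tail

/-! ### Asymptotic independence of the density -/

section Mixing

variable {Ω : Type*} [MeasurableSpace Ω] {μ : Measure Ω} {𝒳 : ℕ → Type*}
  [∀ i, MeasurableSpace (𝒳 i)] {X : ∀ i, Ω → 𝒳 i} {B : Set (Ω → ℝ)} {N : (Ω → ℝ) → ℝ}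

/-- Decay of correlations for real-valued functions, uniformly in their bound. -/
theorem DecayOfCorrelations.exists_abs_integral_sub_le (hB : DecayOfCorrelations μ X B N)
    {s : Ω → ℝ} (hs : s ∈ B) (hs1 : ∫ ω, s ω ∂μ = 1) {M ε : ℝ} (hM : 0 ≤ M) (hε : 0 < ε) :
    ∃ k, ∀ f : TailSpace 𝒳 k → ℝ, Measurable f → (∀ y, |f y| ≤ M) →
      |∫ ω, s ω * f (tailMap X k ω) ∂μ - ∫ ω, f (tailMap X k ω) ∂μ| ≤ ε := by
  obtain ⟨-, δ, hδ, h⟩ := hB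
  -- `N s` and `δ k` may be negative, hence the absolute values.
  have hlim : Tendsto (fun k => |N s| * M * |δ k|) atTop (𝓝 0) := by
    simpa using hδ.abs.const_mul (|N s| * M)
  obtain ⟨k, hk⟩ := (hlim.eventually_le_const hε).exists
  refine ⟨k, fun f hf hfM => ?_⟩
  have hn : ∀ y, ‖(f y : ℂ)‖ ≤ M := fun y => by simpa using hfM y
  have h1 := h k s hs hs1 (fun y => (f y : ℂ)) (Complex.measurable_ofReal.comp hf)
    ⟨M, by rintro _ ⟨y, rfl⟩; exact hn y⟩
  have h2 : ∀ ω, (s ω : ℂ) * (f (tailMap X k ω) : ℂ) = ((s ω * f (tailMap X k ω) : ℝ) : ℂ) :=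
    fun ω => by push_cast; rfl
  simp only [h2, hs1, integral_complex_ofReal, Complex.ofReal_one, one_mul] at h1
  rw [← Complex.ofReal_sub, Complex.norm_real, Real.norm_eq_abs] at h1
  refine h1.trans (le_trans ?_ hk)
  have h3 : 0 ≤ ⨆ y, ‖(f y : ℂ)‖ := Real.iSup_nonneg fun y => norm_nonneg _
  calc N s * (⨆ y, ‖(f y : ℂ)‖) * δ k ≤ |N s * (⨆ y, ‖(f y : ℂ)‖) * δ k| := le_abs_self _
    _ = |N s| * (⨆ y, ‖(f y : ℂ)‖) * |δ k| := by rw [abs_mul, abs_mul, abs_of_nonneg h3]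
    _ ≤ |N s| * M * |δ k| := by gcongr; exact Real.iSup_le hn hM

/-- Let `r` be an `L¹`-limit of elements of `B` of integral one, and let `W n` be, for every `k`,
asymptotically close to functions of `X̄ₖ`. Then `r` is asymptotically independent of `W n`. -/
theorem DecayOfCorrelations.tendsto_integral_mul_sub [IsProbabilityMeasure μ]
    (hB : DecayOfCorrelations μ X B N) (hX : ∀ i, Measurable (X i)) {E : Type*} [UniformSpace E]
    [MeasurableSpace E] [OpensMeasurableSpace E] {W : ℕ → Ω → E} (hW : ∀ n, Measurable (W n))
    {V : ∀ k, ℕ → TailSpace 𝒳 k → E} (hV : ∀ k n, Measurable (V k n))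
    (hWV : ∀ k ω, ∀ U ∈ 𝓤 E, ∀ᶠ n in atTop, (W n ω, V k n (tailMap X k ω)) ∈ U)
    {r : Ω → ℝ} (hr : Integrable r μ)
    (hrB : ∀ ε : ℝ, 0 < ε → ∃ s ∈ B, ∫ ω, s ω ∂μ = 1 ∧ ∫ ω, |r ω - s ω| ∂μ < ε)
    {F : E → ℝ} (hF : UniformContinuous F) (hFb : ∃ M, ∀ x, |F x| ≤ M) :
    Tendsto (fun n => ∫ ω, r ω * F (W n ω) ∂μ - ∫ ω, F (W n ω) ∂μ) atTop (𝓝 0) := by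
  obtain ⟨M', hM'⟩ := hFb
  obtain ⟨M, hM0, hM⟩ : ∃ M, 0 < M ∧ ∀ x, |F x| ≤ M :=
    ⟨max M' 1, lt_max_of_lt_right one_pos, fun x => (hM' x).trans (le_max_left _ _)⟩
  have hFm : Measurable F := hF.continuous.measurable
  rw [Metric.tendsto_nhds]
  intro ε hε
  -- Since `|F| ≤ M`, this tolerance makes replacing `r` by `s` cost less than `ε / 3`.
  obtain ⟨s, hsB, hs1, hrs⟩ := hrB (ε / 3 / M) (by positivity)
  obtain ⟨k, hk⟩ := hB.exists_abs_integral_sub_le hsB hs1 hM0.le (by positivity : 0 < ε / 3)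
  have hs : Integrable s μ := hB.1 s hsB
  have hVm : ∀ n, Measurable fun ω => F (V k n (tailMap X k ω)) := fun n =>
    hFm.comp ((hV k n).comp (measurable_tailMap hX k))
  have hWm : ∀ n, Measurable fun ω => F (W n ω) := fun n => hFm.comp (hW n)
  have hint : ∀ {u : Ω → ℝ} {G : Ω → ℝ}, Integrable u μ → Measurable G → (∀ ω, |G ω| ≤ M) →
      Integrable (fun ω => u ω * G ω) μ := fun hu hG hGM =>
    hu.mul_bdd hG.aestronglyMeasurable (Eventually.of_forall hGM)
  have hint1 : ∀ {G : Ω → ℝ}, Measurable G → (∀ ω, |G ω| ≤ M) → Integrable G μ :=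
    fun hG hGM => by simpa using hint (integrable_const 1) hG hGM
  -- With `k` fixed, dominated convergence applies: the bracket tends to `0` pointwise and is at
  -- most `2 * M`.
  have hlim : Tendsto (fun n => ∫ ω, (r ω - 1) * (F (W n ω) - F (V k n (tailMap X k ω))) ∂μ) atTop
      (𝓝 0) := by
    have h0 : (0 : ℝ) = ∫ _ : Ω, (0 : ℝ) ∂μ := by simp
    rw [h0]
    refine tendsto_integral_of_dominated_convergence (fun ω => |r ω - 1| * (M + M)) (fun n => ?_)
      ((hr.sub (integrable_const 1)).abs.mul_const _) (fun n => Eventually.of_forall fun ω => ?_)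
      (Eventually.of_forall fun ω => ?_)
    · exact (hr.aestronglyMeasurable.sub aestronglyMeasurable_const).mul
        ((hWm n).sub (hVm n)).aestronglyMeasurable
    · rw [norm_mul, Real.norm_eq_abs, Real.norm_eq_abs]
      gcongr
      exact (abs_sub _ _).trans (add_le_add (hM _) (hM _))
    · have h1 : Tendsto (fun n => F (W n ω) - F (V k n (tailMap X k ω))) atTop (𝓝 0) := by
        rw [Metric.tendsto_nhds]
        intro η hη
        filter_upwards [hWV k ω _ (hF (Metric.dist_mem_uniformity hη))] with n hn
        rw [Real.dist_0_eq_abs, ← Real.dist_eq]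
        exact hn
      simpa using h1.const_mul (r ω - 1)
  filter_upwards [Metric.tendsto_nhds.1 hlim (ε / 3) (by positivity)] with n hn
  have h2 := hk (fun y => F (V k n y)) (hFm.comp (hV k n)) fun y => hM _
  have h3 : |∫ ω, (r ω - s ω) * F (V k n (tailMap X k ω)) ∂μ| < ε / 3 := by
    calc |∫ ω, (r ω - s ω) * F (V k n (tailMap X k ω)) ∂μ|
        ≤ ∫ ω, |(r ω - s ω) * F (V k n (tailMap X k ω))| ∂μ := abs_integral_le_integral_abs
      _ ≤ ∫ ω, |r ω - s ω| * M ∂μ := by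
          refine integral_mono (hint (hr.sub hs) (hVm n) fun ω => hM _).abs
            ((hr.sub hs).abs.mul_const _) fun ω => ?_
          simp only [abs_mul]
          gcongr
          exact hM _
      _ = (∫ ω, |r ω - s ω| ∂μ) * M := integral_mul_const _ _
      _ < ε / 3 := (lt_div_iff₀ hM0).1 hrs
  have hrW := hint hr (hWm n) fun ω => hM _
  have hrV := hint hr (hVm n) fun ω => hM _
  have hsV := hint hs (hVm n) fun ω => hM _
  have hW1 := hint1 (hWm n) fun ω => hM _
  have hV1 := hint1 (hVm n) fun ω => hM _
  -- With `V` for the truncated path, `(r - 1) F(W) = (r - 1)(F(W) - F(V)) + (r - s) F(V) + (s - 1)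
  -- F(V)`; each integral costs at most `ε / 3`.
  have h4 : ∫ ω, (r ω - 1) * (F (W n ω) - F (V k n (tailMap X k ω))) ∂μ =
      (∫ ω, r ω * F (W n ω) ∂μ - ∫ ω, r ω * F (V k n (tailMap X k ω)) ∂μ) -
        (∫ ω, F (W n ω) ∂μ - ∫ ω, F (V k n (tailMap X k ω)) ∂μ) := by
    rw [← integral_sub hrW hrV, ← integral_sub hW1 hV1,
      ← integral_sub (f := fun ω => _ - _) (g := fun ω => _ - _) (hrW.sub hrV) (hW1.sub hV1)]
    exact integral_congr_ae (Eventually.of_forall fun ω => by simp only; ring)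
  have h5 : ∫ ω, (r ω - s ω) * F (V k n (tailMap X k ω)) ∂μ =
      ∫ ω, r ω * F (V k n (tailMap X k ω)) ∂μ - ∫ ω, s ω * F (V k n (tailMap X k ω)) ∂μ := by
    rw [← integral_sub hrV hsV]
    exact integral_congr_ae (Eventually.of_forall fun ω => by simp only; ring)
  rw [Real.dist_0_eq_abs] at hn ⊢
  rw [h4] at hn
  rw [h5] at h3
  rw [abs_lt] at *
  rw [abs_le] at h2
  constructor <;> linarith [hn.1, hn.2, h2.1, h2.2, h3.1, h3.2]

/-- On a probability space, `L^p`-closeness, `p ≥ 1`, gives `L¹`-closeness. -/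
theorem MemLpClosure.exists_integral_abs_sub_lt [IsProbabilityMeasure μ] {p : ℝ≥0∞} (hp : 1 ≤ p)
    {A : Set (Ω → ℝ)} (hA : ∀ s ∈ A, Integrable s μ) {r : Ω → ℝ} (hri : Integrable r μ)
    (hr : MemLpClosure p μ A r) {ε : ℝ} (hε : 0 < ε) :
    ∃ s ∈ A, ∫ ω, |r ω - s ω| ∂μ < ε := by
  obtain ⟨s, hs, h⟩ := hr (ENNReal.ofReal ε) (ENNReal.ofReal_pos.2 hε)
  refine ⟨s, hs, ?_⟩
  have hint := hri.sub (hA s hs)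
  have h1 := (eLpNorm_le_eLpNorm_of_exponent_le hp hint.aestronglyMeasurable).trans_lt h
  rw [eLpNorm_one_eq_lintegral_enorm, ← ofReal_integral_norm_eq_lintegral_enorm hint] at h1
  exact (ENNReal.ofReal_lt_ofReal_iff hε).1 h1

end Mixing

theorem mainTheorem5 {Ω : Type*} [MeasurableSpace Ω] (μ : Measure Ω) [IsProbabilityMeasure μ]
    {𝒳 : ℕ → Type*} [∀ i, MeasurableSpace (𝒳 i)]
    (X : ∀ i, Ω → 𝒳 i) (hX : ∀ i, Measurable (X i))
    (B : Set (Ω → ℝ)) (N : (Ω → ℝ) → ℝ) (hB : DecayOfCorrelations μ X B N)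
    {d : ℕ} (g : ∀ j, TailSpace 𝒳 j → EuclideanSpace ℝ (Fin d)) (hg : ∀ j, Measurable (g j))
    (r : Ω → ℝ) (hr0 : ∀ ω, 0 ≤ r ω) (hri : Integrable r μ) (hr1 : ∫ ω, r ω ∂μ = 1)
    (ν : Measure Ω) [IsProbabilityMeasure ν]
    (hν : ν = μ.withDensity fun ω => ENNReal.ofReal (r ω))
    (hr : (r ∈ B ∧ ∀ n, Integrable (fun ω => ‖partialSum X g n ω‖) μ ∧
            Integrable (fun ω => r ω * ‖partialSum X g n ω‖) μ) ∨
          ∃ p q : ℝ≥0∞, ENNReal.HolderConjugate p q ∧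
            MemLpClosure p μ {s | s ∈ B ∧ MemLp s p μ ∧ ∫ ω, s ω ∂μ = 1} r ∧
            ∀ j, MemLp (fun ω => g j (tailMap X j ω)) q μ)
    (b : ℕ → ℝ) (hb0 : ∀ n, 1 ≤ n → 0 < b n) (hb : Tendsto b atTop atTop)
    (P : Measure (SkorokhodSpace (EuclideanSpace ℝ (Fin d)))) [IsProbabilityMeasure P] :
    (TendstoInDistribution (sumProcess X g b) atTop id (fun _ => μ) P →
      TendstoInDistribution (sumProcess X g b) atTop id (fun _ => ν) P) ∧
    ((∀ᵐ ω ∂μ, 0 < r ω) →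
      TendstoInDistribution (sumProcess X g b) atTop id (fun _ => ν) P →
      TendstoInDistribution (sumProcess X g b) atTop id (fun _ => μ) P) := by
  -- Both alternatives enter only through `L¹`-approximability of `r`; in the first, `s = r`.
  have hrB : ∀ ε : ℝ, 0 < ε → ∃ s ∈ B, ∫ ω, s ω ∂μ = 1 ∧ ∫ ω, |r ω - s ω| ∂μ < ε := by
    intro ε hε
    rcases hr with ⟨hr, -⟩ | ⟨p, q, hpq, hr, -⟩
    · exact ⟨r, hr, hr1, by simpa using hε⟩
    · obtain ⟨s, ⟨hsB, -, hs1⟩, hs⟩ := hr.exists_integral_abs_sub_lt hpq.one_le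
        (fun s hs => hB.1 s hs.1) hri hε
      exact ⟨s, hsB, hs1, hs⟩
  have hW : ∀ n, Measurable (sumProcess X g b n) := measurable_sumProcess hX hg b
  have key : ∀ F : SkorokhodSpace (EuclideanSpace ℝ (Fin d)) → ℝ, UniformContinuous F →
      (∃ M, ∀ x, |F x| ≤ M) → Tendsto (fun n => ∫ ω, F (sumProcess X g b n ω) ∂ν -
        ∫ ω, F (sumProcess X g b n ω) ∂μ) atTop (𝓝 0) := by
    intro F hF hFb
    refine (hB.tendsto_integral_mul_sub hX hW (measurable_tailProcess hg b)
      (fun k ω U hU => eventually_sumProcess_tailProcess_mem X g hb k ω hU) hri hrB hF hFb).congr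
      fun n => ?_
    rw [hν, integral_withDensity_eq_integral_toReal_smul₀ hri.aemeasurable.ennreal_ofReal
      (Eventually.of_forall fun _ => ENNReal.ofReal_lt_top)]
    simp only [ENNReal.toReal_ofReal (hr0 _), smul_eq_mul]
  refine ⟨TendstoInDistribution.of_forall_uniformContinuous hW key, fun _ =>
    TendstoInDistribution.of_forall_uniformContinuous hW fun F hF hFb => ?_⟩
  simpa using (key F hF hFb).neg
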